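/- Let $X$ and $A$ be Borel spaces (Borel subsets of Polish spaces, with the induced topology and Borel $\sigma$-algebra), and for every $x\in X$ let $A(x)\subseteq A$ be a nonempty measurable set such that $\mathbb{K}=\{(x,a)\in X\times A: a\in A(x)\}$ is a measurable subset of $X\times A$. Let $T$ be a stochastic kernel on $X$ given $\mathbb{K}$, let $q\in\mathbb{N}$, let $\mathcal{C}_0,\mathcal{C}_1,\dots,\mathcal{C}_q:\mathbb{K}\to\mathbb{R}$ be measurable functions, let $R_1,\dots,R_q\in\mathbb{R}$, and let $\nu$ be a probability measure on $X$. For $t\in\mathbb{N}$ let $H_t=\mathbb{K}^t\times X$ be the set of histories $h_t=(x_0,a_0,\dots,x_{t-1},a_{t-1},x_t)$. A policy is a sequence $\pi=(\pi_t)_{t\in\mathbb{N}}$ of stochastic kernels $\pi_t$ on $A$ given $H_t$ with $\pi_t(h_t;A(x_t))=1$ for all $h_t\in H_t$; $\Pi$ is the set of all policies. A randomized stationary policy is a stochastic kernel $\varphi$ on $A$ given $X$ with $\varphi(x;A(x))=1$ for all $x\in X$, identified with the policy $\pi_t(h_t;\cdot)=\varphi(x_t;\cdot)$. For $\pi\in\Pi$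 let $P^\pi_\nu$ be the law of the process $((x_t,a_t))_{t\in\mathbb{N}}$ determined by $x_0\sim\nu$, $P^\pi_\nu(a_t\in C\mid h_t)=\pi_t(h_t;C)$ and $P^\pi_\nu(x_{t+1}\in B\mid h_t,a_t)=T(x_t,a_t;B)$, and let $E^\pi_\nu$ be the corresponding expectation. Put $$v_i(\nu,\pi)=E^\pi_\nu\Big[\sum_{t=0}^\infty \mathcal{C}_i(x_t,a_t)\Big]\quad(0\le i\le q),\qquad v(\nu,\pi)=v_0(\nu,\pi),$$ $$\Pi_c=\{\pi\in\Pi: v_i(\nu,\pi)\le R_i \text{ for } 1\le i\le q\},\qquad \mu^\pi(\Gamma)=\sum_{t=0}^\infty P^\pi_\nu\big((x_t,a_t)\in\Gamma\big)\quad\text{for } \Gamma\in\mathcal{B}(\mathbb{K}).$$ Let $\mathbb{L}$ be the set of all positive (not necessarily finite) measures $\gamma$ on $\mathbb{K}$ such that $$\gamma\big((\Gamma\times A)\cap\mathbb{K}\big)=\nu(\Gamma)+\int_{\mathbb{K}}T(x,a;\Gamma)\,\gamma(d(x,a))\quad\text{for all }\Gamma\in\mathcal{B}(X),$$ and $\gamma(\mathcal{C}_k)=\int_{\mathbb{K}}\mathcal{C}_k\,d\gamma\le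 R_k$ for $1\le k\le q$. Theorem. Assume that (i) $A(x)$ is compact for every $x\in X$ and the multifunction $x\mapsto A(x)$ is upper semicontinuous; (ii) $\mathcal{C}_0,\dots,\mathcal{C}_q$ are non-negative and lower semicontinuous on $\mathbb{K}$; (iii) $T$ is weakly continuous, i.e. $(x,a)\mapsto\int_X f(y)\,T(x,a;dy)$ is continuous on $\mathbb{K}$ for every bounded continuous $f:X\to\mathbb{R}$; (iv) there is $\beta\in\mathbb{L}$ with $\beta(\mathcal{C}_0)<\infty$. Then there exists a randomized stationary policy $\varphi^*\in\Pi_c$ such that $\mu^{\varphi^*}\in\mathbb{L}$ and $$\inf_{\gamma\in\mathbb{L}}\gamma(\mathcal{C}_0)=\mu^{\varphi^*}(\mathcal{C}_0)=\inf_{\pi\in\Pi_c}v(\nu,\pi)=v(\nu,\varphi^*).$$ -/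

import Mathlib

open MeasureTheory ProbabilityTheory
open scoped ENNReal

/-- The set of feasible state-action pairs `{(x, a) : a ∈ A(x)}`. -/
abbrev feasiblePairs {X A : Type*} (actions : X → Set A) : Set (X × A) :=
  {p | p.2 ∈ actions p.1}

/-- A constrained Markov decision process with state space `X`, action space `A`, `q` constraints:
feasible action sets `A(x)`, a stochastic kernel `T` on `X` given the feasible pairs, a running
cost (index `0`), `q` constraint costs (indices `1, …, q`), and constraint limits. -/
structure ConstrainedMDP (X A : Type*) [MeasurableSpace X] [MeasurableSpace A] (q : ℕ) where
  /-- `A(x)`, the set of actions that are feasible in state `x`. -/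
  actions : X → Set A
  actions_nonempty : ∀ x, (actions x).Nonempty
  measurableSet_actions : ∀ x, MeasurableSet (actions x)
  measurableSet_feasiblePairs : MeasurableSet (feasiblePairs actions)
  /-- The transition law. -/
  T : Kernel (feasiblePairs actions) X
  isMarkovKernel_T : IsMarkovKernel T
  /-- The cost functions `C₀, C₁, …, C_q`. -/
  cost : Fin (q + 1) → feasiblePairs actions → ℝ
  measurable_cost : ∀ i, Measurable (cost i)
  /-- The constraint limits `R₁, …, R_q`; `limit j` bounds the cost with index `j.succ`. -/
  limit : Fin q → ℝ

namespace ConstrainedMDP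

variable {X A : Type*} [MeasurableSpace X] [MeasurableSpace A] {q : ℕ}

/-- The space of feasible state-action pairs of the model. -/
abbrev K (M : ConstrainedMDP X A q) : Type _ := feasiblePairs M.actions

instance (M : ConstrainedMDP X A q) : IsMarkovKernel M.T := M.isMarkovKernel_T

/-- Histories `(x₀, a₀, …, x_{t-1}, a_{t-1}, x_t)` up to time `t`: `t` feasible state-action pairs
followed by the current state. -/
abbrev History (M : ConstrainedMDP X A q) (t : ℕ) : Type _ := (Fin t → M.K) × X

/-- A (randomized, history-dependent) policy: for each `t` a stochastic kernel `π_t` on `A` given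
the histories up to time `t`, which chooses feasible actions, `π_t(h_t; A(x_t)) = 1`. -/
structure Policy (M : ConstrainedMDP X A q) where
  kernel : (t : ℕ) → Kernel (M.History t) A
  isMarkovKernel : ∀ t, IsMarkovKernel (kernel t)
  feasible : ∀ (t : ℕ) (h : M.History t), kernel t h (M.actions h.2) = 1

/-- A randomized stationary policy: a stochastic kernel `φ` on `A` given `X` with
`φ(x; A(x)) = 1` for every `x`. -/
structure StationaryPolicy (M : ConstrainedMDP X A q) where
  kernel : Kernel X A
  isMarkovKernel : IsMarkovKernel kernel
  feasible : ∀ x, kernel x (M.actions x) = 1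

/-- A randomized stationary policy viewed as a policy: `π_t(h_t; ·) = φ(x_t; ·)`. -/
def StationaryPolicy.toPolicy {M : ConstrainedMDP X A q} (φ : M.StationaryPolicy) : M.Policy where
  kernel _ := φ.kernel.comap Prod.snd measurable_snd
  isMarkovKernel t := by
    have := φ.isMarkovKernel
    infer_instance
  feasible t h := by
    rw [Kernel.comap_apply]
    exact φ.feasible h.2

namespace Policy

variable {M : ConstrainedMDP X A q}

instance (π : M.Policy) (t : ℕ) : IsMarkovKernel (π.kernel t) := π.isMarkovKernel t

/-- The conditional law of the feasible pair `(x_t, a_t)` given the history `h_t`: the state is the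
last state of `h_t`, the action is drawn from `π_t(h_t; ·)`. -/
noncomputable def pairKernel (π : M.Policy) (t : ℕ) : Kernel (M.History t) M.K :=
  (Kernel.deterministic Prod.snd measurable_snd ×ₖ π.kernel t).comapRight
    (MeasurableEmbedding.subtype_coe M.measurableSet_feasiblePairs)

instance (π : M.Policy) (t : ℕ) : IsMarkovKernel (π.pairKernel t) := by
  refine Kernel.IsMarkovKernel.comapRight _ _ fun h => ?_
  rw [Subtype.range_coe, Kernel.prod_apply, Kernel.deterministic_apply,
    Measure.dirac_prod, Measure.map_apply measurable_prodMk_left M.measurableSet_feasiblePairs]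
  exact π.feasible t h

/-- The pairs `(x₀, a₀), …, (x_t, a_t)`, indexed by `Fin (t + 1)`. -/
def pastPairs (M : ConstrainedMDP X A q) (t : ℕ) (h : (i : Finset.Iic t) → M.K) :
    Fin (t + 1) → M.K :=
  fun j => h ⟨j, Finset.mem_Iic.2 (Nat.lt_succ_iff.1 j.2)⟩

theorem measurable_pastPairs (M : ConstrainedMDP X A q) (t : ℕ) : Measurable (pastPairs M t) :=
  measurable_pi_lambda _ fun _ => measurable_pi_apply _

/-- The conditional law of the history `h_{t+1}` given `(x₀, a₀), …, (x_t, a_t)`: the new state is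
drawn from `T(x_t, a_t; ·)`. -/
noncomputable def historyKernel (M : ConstrainedMDP X A q) (t : ℕ) :
    Kernel ((i : Finset.Iic t) → M.K) (M.History (t + 1)) :=
  Kernel.deterministic (pastPairs M t) (measurable_pastPairs M t) ×ₖ
    M.T.comap (fun h => h ⟨t, Finset.mem_Iic.2 le_rfl⟩) (measurable_pi_apply _)

instance (M : ConstrainedMDP X A q) (t : ℕ) : IsMarkovKernel (historyKernel M t) := by
  unfold historyKernel
  infer_instance

/-- The conditional law of `(x_{t+1}, a_{t+1})` given `(x₀, a₀), …, (x_t, a_t)`. -/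
noncomputable def stepKernel (π : M.Policy) (t : ℕ) :
    Kernel ((i : Finset.Iic t) → M.K) M.K :=
  π.pairKernel (t + 1) ∘ₖ historyKernel M t

instance (π : M.Policy) (t : ℕ) : IsMarkovKernel (π.stepKernel t) := by
  unfold stepKernel
  infer_instance

/-- The law of `(x₀, a₀)` when `x₀` has law `ν`. -/
noncomputable def initialLaw (π : M.Policy) (ν : Measure X) : Measure M.K :=
  (ν.map fun x => ((Fin.elim0, x) : M.History 0)).bind (π.pairKernel 0)

/-- The strategic measure `P^π_ν`: the law of the state-action process `((x_t, a_t))_{t ∈ ℕ}` under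
the policy `π` with initial distribution `ν`, given by the Ionescu-Tulcea theorem. It is the
measure on the feasible trajectories, on which `P^π_ν` is concentrated. -/
noncomputable def pathMeasure (π : M.Policy) (ν : Measure X) : Measure (ℕ → M.K) :=
  Kernel.trajMeasure (X := fun _ => M.K) (π.initialLaw ν) π.stepKernel

/-- The expected total cost `E^π_ν[∑_t C_i(x_t, a_t)]`, for a non-negative cost `C_i`
(index `0` is the cost to be minimized). -/
noncomputable def value (π : M.Policy) (ν : Measure X) (i : Fin (q + 1)) : ℝ≥0∞ :=
  ∫⁻ ω, ∑' t, ENNReal.ofReal (M.cost i (ω t)) ∂(π.pathMeasure ν)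

/-- The occupation measure `μ^π(Γ) = ∑_t P^π_ν((x_t, a_t) ∈ Γ)` on the feasible pairs. -/
noncomputable def occupationMeasure (π : M.Policy) (ν : Measure X) : Measure M.K :=
  Measure.sum fun t => (π.pathMeasure ν).map fun ω => ω t

end Policy

/-- The set `Π_c` of policies that satisfy all the constraints. The comparison is made in the
extended reals, since a limit may be negative. -/
def feasiblePolicies (M : ConstrainedMDP X A q) (ν : Measure X) : Set M.Policy :=
  {π | ∀ j : Fin q, (π.value ν j.succ : EReal) ≤ (M.limit j : EReal)}

/-- The integral `γ(C_i)` of a non-negative cost. -/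
noncomputable def costIntegral (M : ConstrainedMDP X A q) (γ : Measure M.K) (i : Fin (q + 1)) :
    ℝ≥0∞ :=
  ∫⁻ k, ENNReal.ofReal (M.cost i k) ∂γ

/-- The feasible set of the linear program: the (not necessarily finite) measures `γ` on the
feasible pairs such that `γ((Γ × A) ∩ K) = ν(Γ) + ∫ T(x, a; Γ) γ(d(x, a))` for all measurable `Γ`
and `γ(C_j) ≤ R_j` for all constraints. -/
def lpFeasible (M : ConstrainedMDP X A q) (ν : Measure X) : Set (Measure M.K) :=
  {γ | (∀ Γ : Set X, MeasurableSet Γ →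
      γ {k | k.1.1 ∈ Γ} = ν Γ + ∫⁻ k, M.T k Γ ∂γ) ∧
    ∀ j : Fin q, (M.costIntegral γ j.succ : EReal) ≤ (M.limit j : EReal)}

end ConstrainedMDP

/-!
The time marginals of any policy, and hence its occupation measure, satisfy the balance equation of
the linear program, and the value of the policy is the integral of the cost against the occupation
measure. So the infimum of the linear program is at most the infimum over policies, and it remains
to find a stationary policy whose values are at most the costs of an optimal measure.

*Domination by a stationary policy* (`ConstrainedMDP.exists_stationaryPolicy_value_le`). A feasible
measure `γ` need not be σ-finite, so it cannot be disintegrated as it stands. Let `V_n` be the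
minimal `n`-step value for the sum `c` of all costs. The balance equation gives
`∫ V_n dγ̂ ≤ n ∫ c dγ < ∞` for the state marginal `γ̂`, which is therefore σ-finite on the set where
some `V_n` is positive. There the policy follows the conditional law of the action under `γ`. On the
remaining set, where all `V_n` vanish, compactness of the action sets gives actions that cost nothing
and never leave the set, and they can be chosen measurably (`exists_measurable_selection`). The
policy then never returns from the idle set, and induction on the horizon bounds its expected visits
outside of the idle set by `γ̂` (`ConstrainedMDP.sum_setLIntegral_marginal_le`). All costs on the idle
set are zero.

*Attainment* (`ConstrainedMDP.exists_lpFeasible_costIntegral_le`). By domination, a minimizing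
sequence may be replaced by occupation measures of stationary policies. Their time marginals have a
weakly convergent subsequence (`ConstrainedMDP.exists_subseq_tendsto_flow`): the state and action
spaces are embedded into Hilbert cubes, where compactness is automatic, and the limits are shown to
live on the feasible pairs by induction on time, using that the transition law is weakly continuous
and that the graph of the action correspondence is closed. The sum of the limits is balanced, and
lower semicontinuity of the costs makes it optimal. No tightness and no limit of the laws on the path
space is needed.
-/

/-! ### Lower semicontinuous functions and weak convergence -/

open Filter Topology Set in
theorem lintegral_eq_lintegral_Ioi_measure_lt {α : Type*} [MeasurableSpace α] (μ : Measure α)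
    [SFinite μ] {f : α → ℝ≥0∞} (hf : Measurable f) :
    ∫⁻ x, f x ∂μ = ∫⁻ t in Ioi (0 : ℝ), μ {x | ENNReal.ofReal t < f x} := by
  have hvol (c : ℝ≥0∞) : ∫⁻ t in Ioi (0 : ℝ), {s : ℝ | ENNReal.ofReal s < c}.indicator 1 t = c := by
    have hm : MeasurableSet {s : ℝ | ENNReal.ofReal s < c} :=
      measurableSet_lt ENNReal.measurable_ofReal measurable_const
    rw [lintegral_indicator_one hm, Measure.restrict_apply hm]
    induction c with
    | top => simp
    | coe c =>
      have : {s : ℝ | ENNReal.ofReal s < c} ∩ Ioi 0 = Ioo 0 (c : ℝ) := by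
        ext s
        simp only [mem_inter_iff, mem_ofPred, mem_Ioi, mem_Ioo]
        constructor
        · rintro ⟨h, h0⟩
          refine ⟨h0, ?_⟩
          rwa [← ENNReal.ofReal_coe_nnreal, ENNReal.ofReal_lt_ofReal_iff_of_nonneg h0.le] at h
        · rintro ⟨h0, h⟩
          refine ⟨?_, h0⟩
          rwa [← ENNReal.ofReal_coe_nnreal, ENNReal.ofReal_lt_ofReal_iff_of_nonneg h0.le]
      rw [this]
      simp
  have hm : MeasurableSet {p : α × ℝ | ENNReal.ofReal p.2 < f p.1} :=
    measurableSet_lt (ENNReal.measurable_ofReal.comp measurable_snd) (hf.comp measurable_fst)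
  calc ∫⁻ x, f x ∂μ
      = ∫⁻ x, (∫⁻ t in Ioi (0 : ℝ),
          {p : α × ℝ | ENNReal.ofReal p.2 < f p.1}.indicator 1 (x, t)) ∂μ :=
        lintegral_congr fun x => (hvol (f x)).symm
    _ = ∫⁻ t in Ioi (0 : ℝ), (∫⁻ x,
          {p : α × ℝ | ENNReal.ofReal p.2 < f p.1}.indicator 1 (x, t) ∂μ) :=
        lintegral_lintegral_swap (f := fun x t =>
          {p : α × ℝ | ENNReal.ofReal p.2 < f p.1}.indicator 1 (x, t))
          (measurable_one.indicator hm).aemeasurable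
    _ = _ := by
        refine lintegral_congr fun t => ?_
        exact lintegral_indicator_one (hm.preimage (measurable_prodMk_right (y := t)))

open Filter Topology Set in
/-- The portmanteau inequality for lower semicontinuous functions: the layer cake formula reduces it
to the superlevel sets, which are open, and Fatou's lemma exchanges the limit and the integral over
the levels. -/
theorem LowerSemicontinuous.lintegral_le_liminf {α : Type*} [TopologicalSpace α]
    [MeasurableSpace α] [OpensMeasurableSpace α] {f : α → ℝ≥0∞} (hf : LowerSemicontinuous f)
    {μ : Measure α} [SFinite μ] {μs : ℕ → Measure α} [∀ n, SFinite (μs n)]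
    (h : ∀ G, IsOpen G → μ G ≤ liminf (fun n => μs n G) atTop) :
    ∫⁻ x, f x ∂μ ≤ liminf (fun n => ∫⁻ x, f x ∂(μs n)) atTop := by
  simp_rw [lintegral_eq_lintegral_Ioi_measure_lt _ hf.measurable]
  calc _ ≤ ∫⁻ t in Ioi (0 : ℝ), liminf (fun n => μs n {x | ENNReal.ofReal t < f x}) atTop :=
        lintegral_mono fun t => h _ (hf.isOpen_preimage _)
    _ ≤ _ := by
        refine lintegral_liminf_le fun n => Antitone.measurable fun s t hst => ?_
        exact measure_mono fun x hx => (ENNReal.ofReal_le_ofReal hst).trans_lt hx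

open Filter Topology Set in
theorem LowerSemicontinuous.lintegral_kernel {α β : Type*} [TopologicalSpace α]
    [FirstCountableTopology α] [MeasurableSpace α] [TopologicalSpace β]
    [MeasurableSpace β] [OpensMeasurableSpace β] [HasOuterApproxClosed β]
    (T : Kernel α β) [IsMarkovKernel T]
    (hT : ∀ f : BoundedContinuousFunction β ℝ, Continuous fun k => ∫ y, f y ∂(T k))
    {f : β → ℝ≥0∞} (hf : LowerSemicontinuous f) :
    LowerSemicontinuous fun k => ∫⁻ y, f y ∂(T k) := by
  rw [lowerSemicontinuous_iff_isClosed_preimage]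
  intro c
  refine IsSeqClosed.isClosed fun u x hu hux => ?_
  let P : α → ProbabilityMeasure β := fun k => ⟨T k, inferInstance⟩
  have hlim : Tendsto (fun n => P (u n)) atTop (𝓝 (P x)) :=
    ProbabilityMeasure.tendsto_iff_forall_integral_tendsto.2 fun f =>
      ((hT f).tendsto x).comp hux
  refine (hf.lintegral_le_liminf (μ := T x) (μs := fun n => T (u n)) fun G hG =>
    ProbabilityMeasure.le_liminf_measure_open_of_tendsto hlim hG).trans ?_
  exact liminf_le_of_le (by isBoundedDefault) fun b hb => by
    obtain ⟨n, hn⟩ := hb.exists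
    exact hn.trans (hu n)

/-! ### Compact-valued correspondences -/

open Filter Topology Set in
/-- The projection of the graph of an upper hemicontinuous compact-valued correspondence to its
domain is a closed map, by the tube lemma. -/
theorem UpperHemicontinuous.isClosedMap_fst {X A : Type*} [TopologicalSpace X] [TopologicalSpace A]
    {F : X → Set A} (hF : UpperHemicontinuous F) (hc : ∀ x, IsCompact (F x)) :
    IsClosedMap fun k : feasiblePairs F => k.1.1 := by
  intro S hS
  obtain ⟨S', hS', rfl⟩ := isClosed_induced_iff.1 hS
  rw [← isOpen_compl_iff, isOpen_iff_mem_nhds]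
  intro x hx
  have hsub : {x} ×ˢ F x ⊆ S'ᶜ := by
    rintro ⟨y, a⟩ ⟨rfl, ha⟩ hmem
    exact hx ⟨⟨(y, a), ha⟩, hmem, rfl⟩
  obtain ⟨U, W, hU, hW, hxU, hFW, hUW⟩ :=
    generalized_tube_lemma isCompact_singleton (hc x) hS'.isOpen_compl hsub
  filter_upwards [hU.mem_nhds (hxU rfl), hF.forall_isOpen x W hW hFW] with y hyU hyW
  rintro ⟨k, hk, rfl⟩
  exact hUW (mk_mem_prod hyU (hyW k.2)) hk

open Filter Topology Set in
/-- Measurable selection for compact-valued correspondences. Intersecting successively with closed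
balls of radii tending to zero, always the first one in an enumeration that meets the current set,
shrinks every value to a point. -/
theorem exists_measurable_selection {X A : Type*} [MeasurableSpace X] [TopologicalSpace A]
    [TopologicalSpace.MetrizableSpace A] [SecondCountableTopology A] [MeasurableSpace A]
    [BorelSpace A] (F : X → Set A) (hne : ∀ x, (F x).Nonempty) (hc : ∀ x, IsCompact (F x))
    (hm : ∀ S, IsClosed S → MeasurableSet {x | (F x ∩ S).Nonempty}) :
    ∃ f : X → A, Measurable f ∧ ∀ x, f x ∈ F x := by
  classical
  let _ := TopologicalSpace.metrizableSpaceMetric A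
  rcases isEmpty_or_nonempty X with hX | ⟨⟨x₀⟩⟩
  · exact ⟨fun x => isEmptyElim x, measurable_of_empty _, fun x => isEmptyElim x⟩
  have : Nonempty A := ⟨(hne x₀).some⟩
  let B : ℕ → ℕ → Set A := fun n j => Metric.closedBall (TopologicalSpace.denseSeq A j) (1 / (n + 1))
  let next : ℕ → (X → Set A) → X → Set A := fun n F x => F x ∩ B n (sInf {j | (F x ∩ B n j).Nonempty})
  let P : (X → Set A) → Prop := fun F => (∀ x, (F x).Nonempty) ∧ (∀ x, IsCompact (F x)) ∧
    ∀ S, IsClosed S → MeasurableSet {x | (F x ∩ S).Nonempty}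
  have hex (n : ℕ) (F : X → Set A) (hF : P F) (x : X) : ∃ j, (F x ∩ B n j).Nonempty := by
    obtain ⟨a, ha⟩ := hF.1 x
    obtain ⟨j, hj⟩ := (TopologicalSpace.denseRange_denseSeq A).exists_dist_lt a
      (Nat.one_div_pos_of_nat (n := n) (α := ℝ))
    exact ⟨j, a, ha, hj.le⟩
  have hnext (n : ℕ) (F : X → Set A) (hF : P F) : P (next n F) := by
    refine ⟨fun x => Nat.sInf_mem (hex n F hF x), fun x => (hF.2.1 x).inter_right
      Metric.isClosed_closedBall, fun S hS => ?_⟩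
    have hj : Measurable fun x => sInf {j | (F x ∩ B n j).Nonempty} := by
      have := measurable_find (p := fun x j => (F x ∩ B n j).Nonempty) (hex n F hF)
        fun j => hF.2.2 _ Metric.isClosed_closedBall
      convert this using 2 with x
      exact Nat.sInf_def (hex n F hF x)
    have : {x | (next n F x ∩ S).Nonempty} = ⋃ i, {x | sInf {j | (F x ∩ B n j).Nonempty} = i} ∩
        {x | (F x ∩ (B n i ∩ S)).Nonempty} := by
      ext x
      simp [next, inter_assoc]
    rw [this]
    exact .iUnion fun i => (hj (measurableSet_singleton i)).inter
      (hF.2.2 _ (Metric.isClosed_closedBall.inter hS))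
  let G : ℕ → X → Set A := fun n => Nat.rec F next n
  have hG (n : ℕ) : P (G n) := by
    induction n with
    | zero => exact ⟨hne, hc, hm⟩
    | succ n ih => exact hnext n _ ih
  have hanti (n : ℕ) (x : X) : G (n + 1) x ⊆ G n x := inter_subset_left
  have hint (S : Set A) (hS : IsClosed S) (x : X) (h : ∀ n, (G n x ∩ S).Nonempty) :
      (⋂ n, G n x ∩ S).Nonempty :=
    IsCompact.nonempty_iInter_of_sequence_nonempty_isCompact_isClosed _
      (fun n => inter_subset_inter_left _ (hanti n x)) h (((hG 0).2.1 x).inter_right hS)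
      fun n => ((hG n).2.1 x).isClosed.inter hS
  have huniq (x : X) (a b : A) (ha : ∀ n, a ∈ G n x) (hb : ∀ n, b ∈ G n x) : a = b := by
    refine eq_of_forall_dist_le fun ε hε => ?_
    obtain ⟨n, hn⟩ := exists_nat_one_div_lt (half_pos hε)
    have h1 := (ha (n + 1)).2
    have h2 := (hb (n + 1)).2
    have := dist_triangle_right a b
      (TopologicalSpace.denseSeq A (sInf {j | (G n x ∩ B n j).Nonempty}))
    have h1' : dist a (TopologicalSpace.denseSeq A (sInf {j | (G n x ∩ B n j).Nonempty}))
      ≤ 1 / (n + 1) := h1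
    have h2' : dist b (TopologicalSpace.denseSeq A (sInf {j | (G n x ∩ B n j).Nonempty}))
      ≤ 1 / (n + 1) := h2
    linarith
  have hsel (x : X) : ∃ a, ∀ n, a ∈ G n x := by
    obtain ⟨a, ha⟩ := hint univ isClosed_univ x fun n => by simpa using (hG n).1 x
    exact ⟨a, fun n => (mem_iInter.1 ha n).1⟩
  choose f hf using hsel
  refine ⟨f, measurable_of_isClosed fun S hS => ?_, fun x => hf x 0⟩
  have : f ⁻¹' S = ⋂ n, {x | (G n x ∩ S).Nonempty} := by
    ext x
    simp only [mem_preimage, mem_iInter, mem_ofPred]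
    refine ⟨fun h n => ⟨f x, hf x n, h⟩, fun h => ?_⟩
    obtain ⟨a, ha⟩ := hint S hS x h
    rw [mem_iInter] at ha
    rw [huniq x (f x) a (hf x) fun n => (ha n).1]
    exact (ha 0).2
  rw [this]
  exact .iInter fun n => (hG n).2.2 S hS

namespace ConstrainedMDP
variable {X A : Type*} [MeasurableSpace X] [MeasurableSpace A] {q : ℕ}

/-! ### Balanced measures and flows of time marginals -/

theorem measurable_state (M : ConstrainedMDP X A q) : Measurable fun k : M.K => k.1.1 :=
  measurable_fst.comp measurable_subtype_coe

/-- The equality constraint of the linear program: the mass that `γ` puts on a set of states is the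
initial mass plus the mass that flows in. -/
def IsBalanced (M : ConstrainedMDP X A q) (ν : Measure X) (γ : Measure M.K) : Prop :=
  γ.map (fun k => k.1.1) = ν + γ.bind M.T

theorem isBalanced_iff {M : ConstrainedMDP X A q} {ν : Measure X} {γ : Measure M.K} :
    M.IsBalanced ν γ ↔ ∀ Γ : Set X, MeasurableSet Γ →
      γ {k | k.1.1 ∈ Γ} = ν Γ + ∫⁻ k, M.T k Γ ∂γ := by
  rw [IsBalanced, Measure.ext_iff]
  refine forall₂_congr fun Γ hΓ => ?_
  rw [Measure.map_apply M.measurable_state hΓ, Measure.add_apply,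
    Measure.bind_apply hΓ M.T.aemeasurable]
  rfl

/-- A sequence of laws of `(x_t, a_t)`, `t ∈ ℕ`, that is compatible with the initial distribution
and the transition law. -/
structure IsMarginalFlow (M : ConstrainedMDP X A q) (ν : Measure X) (p : ℕ → Measure M.K) :
    Prop where
  isProbabilityMeasure : ∀ t, IsProbabilityMeasure (p t)
  zero : (p 0).map (fun k => k.1.1) = ν
  succ : ∀ t, (p (t + 1)).map (fun k => k.1.1) = (p t).bind M.T

theorem IsMarginalFlow.isBalanced_sum {M : ConstrainedMDP X A q} {ν : Measure X}
    {p : ℕ → Measure M.K} (hp : M.IsMarginalFlow ν p) : M.IsBalanced ν (Measure.sum p) := by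
  rw [isBalanced_iff]
  intro Γ hΓ
  have hm : MeasurableSet {k : M.K | k.1.1 ∈ Γ} := M.measurable_state hΓ
  have hmap (t : ℕ) : p t {k | k.1.1 ∈ Γ} = (p t).map (fun k => k.1.1) Γ :=
    (Measure.map_apply M.measurable_state hΓ).symm
  rw [Measure.sum_apply _ hm, lintegral_sum_measure, tsum_eq_zero_add' ENNReal.summable, hmap,
    hp.zero]
  congr 2 with t
  rw [hmap, hp.succ, Measure.bind_apply hΓ M.T.aemeasurable]

namespace Policy
variable {M : ConstrainedMDP X A q}

/-- The law of `(x_t, a_t)` under a policy. -/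
noncomputable def marginal (π : M.Policy) (ν : Measure X) (t : ℕ) : Measure M.K :=
  (π.pathMeasure ν).map fun ω => ω t

theorem pairKernel_map_val (π : M.Policy) (t : ℕ) (h : M.History t) :
    (π.pairKernel t h).map Subtype.val = (Measure.dirac h.2).prod (π.kernel t h) := by
  have he := MeasurableEmbedding.subtype_coe M.measurableSet_feasiblePairs
  rw [pairKernel, Kernel.comapRight_apply, he.map_comap, Kernel.prod_apply,
    Kernel.deterministic_apply, Subtype.range_coe]
  refine Measure.restrict_eq_self_of_ae_mem ?_
  change (feasiblePairs M.actions) ∈ ae _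
  rw [mem_ae_iff, ← prob_compl_eq_one_iff M.measurableSet_feasiblePairs.compl, compl_compl,
    Measure.dirac_prod, Measure.map_apply measurable_prodMk_left M.measurableSet_feasiblePairs]
  exact π.feasible t h

theorem pairKernel_map_state (π : M.Policy) (t : ℕ) (h : M.History t) :
    (π.pairKernel t h).map (fun k => k.1.1) = Measure.dirac h.2 := by
  have := congrArg (Measure.map Prod.fst) (π.pairKernel_map_val t h)
  rw [Measure.map_map measurable_fst measurable_subtype_coe] at this
  rw [← Function.comp_def Prod.fst Subtype.val, this]
  simp [Measure.dirac_prod, Measure.map_map measurable_fst measurable_prodMk_left,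
    Function.comp_def]

/-- The law of the history `h_t` under a policy. -/
noncomputable def historyLaw (π : M.Policy) (ν : Measure X) : (t : ℕ) → Measure (M.History t)
  | 0 => ν.map fun x => ((Fin.elim0, x) : M.History 0)
  | t + 1 => ((π.pathMeasure ν).map (Preorder.frestrictLe t)).bind (historyKernel M t)

variable (π : M.Policy) (ν : Measure X) [IsProbabilityMeasure ν]

theorem measurable_initial : Measurable fun x => ((Fin.elim0, x) : M.History 0) :=
  measurable_const.prodMk measurable_id

instance : IsProbabilityMeasure (π.initialLaw ν) := by
  have : IsProbabilityMeasure (ν.map fun x => ((Fin.elim0, x) : M.History 0)) :=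
    Measure.isProbabilityMeasure_map measurable_initial.aemeasurable
  unfold initialLaw
  infer_instance

instance : IsProbabilityMeasure (π.pathMeasure ν) := by
  unfold pathMeasure
  infer_instance

instance (t : ℕ) : IsProbabilityMeasure (π.marginal ν t) :=
  Measure.isProbabilityMeasure_map (measurable_pi_apply t).aemeasurable

theorem marginal_zero (π : M.Policy) (ν : Measure X) : π.marginal ν 0 = π.initialLaw ν := by
  have h : (π.pathMeasure ν).map (Preorder.frestrictLe 0) =
      (π.initialLaw ν).map (MeasurableEquiv.piUnique fun _ : Finset.Iic 0 => M.K).symm := by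
    rw [pathMeasure, Kernel.trajMeasure, Measure.map_comp _ _ (by fun_prop),
      Kernel.traj_map_frestrictLe, Kernel.partialTraj_self, Measure.id_comp]
  have h' := congrArg (Measure.map fun h => h ⟨0, Finset.mem_Iic.2 le_rfl⟩) h
  rw [Measure.map_map (measurable_pi_apply _) (by fun_prop),
    Measure.map_map (measurable_pi_apply _) (by fun_prop)] at h'
  exact h'.trans Measure.map_id

theorem marginal_succ (t : ℕ) : π.marginal ν (t + 1) =
    ((π.pathMeasure ν).map (Preorder.frestrictLe t)).bind (π.stepKernel t) := by
  have h := congrArg (Measure.map Prod.snd)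
    (Kernel.map_frestrictLe_trajMeasure_compProd_eq_map_trajMeasure (μ₀ := π.initialLaw ν)
      (X := fun _ => M.K) (κ := π.stepKernel) (a := t))
  rw [Measure.map_map measurable_snd (by fun_prop)] at h
  exact h.symm.trans (Measure.snd_compProd _ _)

theorem marginal_eq_bind (t : ℕ) :
    π.marginal ν t = (π.historyLaw ν t).bind (π.pairKernel t) := by
  cases t with
  | zero => exact π.marginal_zero ν
  | succ t => rw [marginal_succ, stepKernel, historyLaw, Measure.comp_assoc]

theorem marginal_map_state (t : ℕ) :
    (π.marginal ν t).map (fun k => k.1.1) = (π.historyLaw ν t).map Prod.snd := by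
  ext Γ hΓ
  rw [marginal_eq_bind, Measure.map_apply M.measurable_state hΓ,
    Measure.bind_apply (M.measurable_state hΓ) (Kernel.aemeasurable _),
    ← lintegral_indicator_one hΓ, lintegral_map (measurable_one.indicator hΓ) measurable_snd]
  refine lintegral_congr fun h => ?_
  rw [← Measure.map_apply M.measurable_state hΓ, pairKernel_map_state,
    Measure.dirac_apply' _ hΓ]

theorem isMarginalFlow_marginal : M.IsMarginalFlow ν (π.marginal ν) where
  isProbabilityMeasure t := inferInstance
  zero := by
    rw [marginal_map_state, historyLaw, Measure.map_map measurable_snd measurable_initial]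
    exact Measure.map_id
  succ t := by
    rw [marginal_map_state, historyLaw]
    have hm : π.marginal ν t = ((π.pathMeasure ν).map (Preorder.frestrictLe t)).map
        (fun h => h ⟨t, Finset.mem_Iic.2 le_rfl⟩) := by
      rw [Measure.map_map (measurable_pi_apply _) (by fun_prop)]
      rfl
    rw [hm]
    ext Γ hΓ
    rw [Measure.map_apply measurable_snd hΓ,
      Measure.bind_apply (measurable_snd hΓ) (Kernel.aemeasurable _),
      Measure.bind_apply hΓ M.T.aemeasurable]
    have he : Measurable fun h : Finset.Iic t → M.K => h ⟨t, Finset.mem_Iic.2 le_rfl⟩ :=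
      measurable_pi_apply _
    refine Eq.trans (lintegral_congr fun h => ?_)
      (lintegral_map (M.T.measurable_coe hΓ) he).symm
    rw [historyKernel, Kernel.prod_apply, Kernel.deterministic_apply, Measure.dirac_prod,
      Measure.map_apply measurable_prodMk_left (measurable_snd hΓ), Kernel.comap_apply]
    rfl

theorem costIntegral_occupationMeasure (π : M.Policy) (ν : Measure X) (i : Fin (q + 1)) :
    M.costIntegral (π.occupationMeasure ν) i = π.value ν i := by
  have hm : Measurable fun k => ENNReal.ofReal (M.cost i k) := (M.measurable_cost i).ennreal_ofReal
  rw [costIntegral, occupationMeasure, lintegral_sum_measure]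
  exact (tsum_congr fun t => lintegral_map hm (measurable_pi_apply t)).trans
    (lintegral_tsum fun t => (hm.comp (measurable_pi_apply t)).aemeasurable).symm

theorem isBalanced_occupationMeasure : M.IsBalanced ν (π.occupationMeasure ν) :=
  (π.isMarginalFlow_marginal ν).isBalanced_sum

theorem occupationMeasure_mem_lpFeasible (hπ : π ∈ M.feasiblePolicies ν) :
    π.occupationMeasure ν ∈ M.lpFeasible ν :=
  ⟨isBalanced_iff.1 (π.isBalanced_occupationMeasure ν), fun j => by
    rw [costIntegral_occupationMeasure]; exact hπ j⟩

end Policy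

namespace StationaryPolicy
variable {M : ConstrainedMDP X A q}

/-- The conditional law of the feasible pair `(x, a)` given the state `x`. -/
noncomputable def pairKernel (φ : M.StationaryPolicy) : Kernel X M.K :=
  (φ.toPolicy.pairKernel 0).comap (fun x => ((Fin.elim0, x) : M.History 0))
    Policy.measurable_initial

theorem toPolicy_pairKernel (φ : M.StationaryPolicy) (t : ℕ) :
    φ.toPolicy.pairKernel t = φ.pairKernel.comap Prod.snd measurable_snd := by
  ext1 h
  simp only [pairKernel, Policy.pairKernel, Kernel.comapRight_apply, Kernel.comap_apply]
  have := φ.isMarkovKernel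
  rw [Kernel.prod_apply, Kernel.prod_apply, Kernel.deterministic_apply, Kernel.deterministic_apply]
  rfl

theorem pairKernel_map_val (φ : M.StationaryPolicy) (x : X) :
    (φ.pairKernel x).map Subtype.val = (Measure.dirac x).prod (φ.kernel x) :=
  φ.toPolicy.pairKernel_map_val 0 _

theorem lintegral_pairKernel (φ : M.StationaryPolicy) (x : X) {g : X × A → ℝ≥0∞}
    (hg : Measurable g) : ∫⁻ k, g k.1 ∂(φ.pairKernel x) = ∫⁻ a, g (x, a) ∂(φ.kernel x) := by
  have := φ.isMarkovKernel
  rw [← lintegral_map hg measurable_subtype_coe, pairKernel_map_val, Measure.dirac_prod,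
    lintegral_map hg measurable_prodMk_left]

/-- Under a stationary policy the state-action pair depends on the past through the state only. -/
theorem marginal_eq_bind (φ : M.StationaryPolicy) (ν : Measure X) [IsProbabilityMeasure ν] (t : ℕ) :
    φ.toPolicy.marginal ν t =
      ((φ.toPolicy.marginal ν t).map fun k => k.1.1).bind φ.pairKernel := by
  rw [Policy.marginal_map_state]
  ext Γ hΓ
  rw [Policy.marginal_eq_bind, Measure.bind_apply hΓ (Kernel.aemeasurable _),
    Measure.bind_apply hΓ (Kernel.aemeasurable _),
    lintegral_map (φ.pairKernel.measurable_coe hΓ) measurable_snd]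
  refine lintegral_congr fun h => ?_
  rw [toPolicy_pairKernel, Kernel.comap_apply]

end StationaryPolicy
end ConstrainedMDP

/-! ### Sequential compactness of marginal flows -/

open Filter Topology Set in
/-- Weak convergence in an ambient space to a measure concentrated on a subspace is weak convergence
in the subspace. -/
theorem exists_tendsto_of_tendsto_map {K Z : Type*} [TopologicalSpace K] [MeasurableSpace K]
    [BorelSpace K] [HasOuterApproxClosed K] [TopologicalSpace Z] [MeasurableSpace Z]
    [BorelSpace Z] [HasOuterApproxClosed Z] {e : K → Z} (he : IsEmbedding e)
    (hem : MeasurableEmbedding e) {μs : ℕ → ProbabilityMeasure K} {ρ : ProbabilityMeasure Z}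
    (hρ : Tendsto (fun n => (μs n).map hem.measurable.aemeasurable) atTop (𝓝 ρ))
    (hrange : (ρ : Measure Z) (range e)ᶜ = 0) :
    ∃ μ : ProbabilityMeasure K, Tendsto μs atTop (𝓝 μ) := by
  have hmap : ((ρ : Measure Z).comap e).map e = ρ := by
    rw [hem.map_comap]
    exact Measure.restrict_eq_self_of_ae_mem (mem_ae_iff.2 hrange)
  have hprob : IsProbabilityMeasure ((ρ : Measure Z).comap e) := by
    constructor
    rw [← preimage_univ (f := e), ← hem.map_apply, hmap, measure_univ]
  refine ⟨⟨(ρ : Measure Z).comap e, hprob⟩,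
    tendsto_of_forall_isOpen_le_liminf' fun G hG => ?_⟩
  obtain ⟨G', hG', rfl⟩ := he.isOpen_iff.1 hG
  have h := ProbabilityMeasure.le_liminf_measure_open_of_tendsto hρ hG'
  simp only [ProbabilityMeasure.toMeasure_map, hem.map_apply] at h
  rw [← hmap, hem.map_apply] at h
  exact h

open Filter Topology Set in
/-- The graph of an upper hemicontinuous compact-valued correspondence stays closed when the values
are embedded into a larger space, as long as the domain is not enlarged. -/
theorem UpperHemicontinuous.mem_range_of_mem_closure {X A Q R : Type*} [TopologicalSpace X]
    [TopologicalSpace A] [TopologicalSpace Q] [TopologicalSpace R] [T2Space R]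
    {F : X → Set A} (hF : UpperHemicontinuous F) (hc : ∀ x, IsCompact (F x))
    {i : X → Q} (hi : IsEmbedding i) {j : A → R} (hj : IsEmbedding j) {z : Q × R}
    (hz : z ∈ closure (range fun k : feasiblePairs F => (i k.1.1, j k.1.2)))
    (hz1 : z.1 ∈ range i) : z ∈ range fun k : feasiblePairs F => (i k.1.1, j k.1.2) := by
  obtain ⟨w, b⟩ := z
  obtain ⟨x, rfl⟩ := hz1
  by_contra hnot
  have hb : b ∉ j '' F x := by
    rintro ⟨a, ha, rfl⟩
    exact hnot ⟨⟨(x, a), ha⟩, rfl⟩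
  obtain ⟨W, V, hW, hV, hjW, hbV, hWV⟩ :=
    SeparatedNhds.of_isCompact_isCompact ((hc x).image hj.continuous) isCompact_singleton
      (disjoint_singleton_right.2 hb)
  have hN : {y | F y ⊆ j ⁻¹' W} ∈ 𝓝 x :=
    hF.forall_isOpen x _ (hW.preimage hj.continuous) (image_subset_iff.1 hjW)
  rw [hi.nhds_eq_comap] at hN
  obtain ⟨N, hN, hNF⟩ := hN
  have hmem : N ×ˢ V ∈ 𝓝 (i x, b) := prod_mem_nhds hN (hV.mem_nhds (hbV rfl))
  obtain ⟨_, ⟨h1, h2⟩, k, rfl⟩ := mem_closure_iff_nhds.1 hz _ hmem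
  exact hWV.le_bot ⟨hNF h1 k.2, h2⟩

namespace ConstrainedMDP

theorem continuous_state {X A : Type*} [TopologicalSpace X] [MeasurableSpace X]
    [TopologicalSpace A] [MeasurableSpace A] {q : ℕ} (M : ConstrainedMDP X A q) :
    Continuous fun k : M.K => k.1.1 :=
  continuous_fst.comp continuous_subtype_val

variable {X A : Type*} [TopologicalSpace X] [TopologicalSpace.MetrizableSpace X]
  [SecondCountableTopology X] [MeasurableSpace X] [BorelSpace X]
  [TopologicalSpace A] [TopologicalSpace.MetrizableSpace A] [SecondCountableTopology A]
  [MeasurableSpace A] [BorelSpace A] {q : ℕ}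

/-- The law of the next state, as a map on laws of state-action pairs. -/
noncomputable def nextState (M : ConstrainedMDP X A q) (μ : ProbabilityMeasure M.K) :
    ProbabilityMeasure X :=
  ⟨(μ : Measure M.K).bind M.T, inferInstance⟩

open Filter Topology Set in
theorem tendsto_nextState (M : ConstrainedMDP X A q)
    (hT : ∀ f : BoundedContinuousFunction X ℝ, Continuous fun k : M.K => ∫ y, f y ∂(M.T k))
    {μs : ℕ → ProbabilityMeasure M.K} {μ : ProbabilityMeasure M.K}
    (h : Tendsto μs atTop (𝓝 μ)) :
    Tendsto (fun n => M.nextState (μs n)) atTop (𝓝 (M.nextState μ)) := by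
  refine tendsto_of_forall_isOpen_le_liminf' fun G hG => ?_
  have hlsc : LowerSemicontinuous fun k : M.K => M.T k G := by
    have := LowerSemicontinuous.lintegral_kernel M.T hT
      (hG.lowerSemicontinuous_indicator (zero_le (a := (1 : ℝ≥0∞))))
    simpa [lintegral_indicator hG.measurableSet] using this
  have := hlsc.lintegral_le_liminf (μ := (μ : Measure M.K)) (μs := fun n => (μs n : Measure M.K))
    fun G hG => ProbabilityMeasure.le_liminf_measure_open_of_tendsto h hG
  simpa only [nextState, ProbabilityMeasure.coe_mk,
    Measure.bind_apply hG.measurableSet M.T.aemeasurable] using this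

variable [StandardBorelSpace X] [StandardBorelSpace A]

instance (M : ConstrainedMDP X A q) : StandardBorelSpace M.K :=
  M.measurableSet_feasiblePairs.standardBorel

open Filter Topology Set in
/-- Every sequence of marginal flows has a subsequence along which all time marginals converge
weakly to those of a marginal flow. After embedding `X` and `A` into Hilbert cubes, a subsequence
converges by compactness. By induction on time the laws of the states converge in `X`, so that the
limit puts no mass outside of `X`; since the graph of the action correspondence is closed over `X`,
the limit is concentrated on the feasible pairs. -/
theorem exists_subseq_tendsto_flow (M : ConstrainedMDP X A q) (ν : Measure X)
    [IsProbabilityMeasure ν] (hcompact : ∀ x, IsCompact (M.actions x))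
    (husc : UpperHemicontinuous M.actions)
    (hT : ∀ f : BoundedContinuousFunction X ℝ, Continuous fun k : M.K => ∫ y, f y ∂(M.T k))
    (P : ℕ → ℕ → ProbabilityMeasure M.K)
    (hP : ∀ n, M.IsMarginalFlow ν fun t => (P n t : Measure M.K)) :
    ∃ (p : ℕ → ProbabilityMeasure M.K) (σ : ℕ → ℕ), StrictMono σ ∧
      M.IsMarginalFlow ν (fun t => (p t : Measure M.K)) ∧
      ∀ t, Tendsto (fun n => P (σ n) t) atTop (𝓝 (p t)) := by
  let _ := TopologicalSpace.metrizableSpaceMetric X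
  let _ := TopologicalSpace.metrizableSpaceMetric A
  obtain ⟨i, hi⟩ := Metric.PiNatEmbed.exists_embedding_to_hilbert_cube (X := X)
  obtain ⟨j, hj⟩ := Metric.PiNatEmbed.exists_embedding_to_hilbert_cube (X := A)
  let Z := (ℕ → unitInterval) × (ℕ → unitInterval)
  let e : M.K → Z := fun k => (i k.1.1, j k.1.2)
  have he : IsEmbedding e := (hi.prodMap hj).comp IsEmbedding.subtypeVal
  have hem : MeasurableEmbedding e := he.continuous.measurable.measurableEmbedding he.injective
  have him : MeasurableEmbedding i := hi.continuous.measurable.measurableEmbedding hi.injective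
  let E : ProbabilityMeasure M.K → ProbabilityMeasure Z :=
    fun μ => μ.map hem.measurable.aemeasurable
  obtain ⟨ρ, σ, hσ, hρ⟩ := CompactSpace.tendsto_subseq fun n t => E (P n t)
  rw [tendsto_pi_nhds] at hρ
  let S : ProbabilityMeasure M.K → ProbabilityMeasure X :=
    fun μ => μ.map M.continuous_state.measurable.aemeasurable
  have hS : Continuous S := ProbabilityMeasure.continuous_map M.continuous_state
  have hzero (n : ℕ) : S (P (σ n) 0) = ⟨ν, inferInstance⟩ := Subtype.ext (hP (σ n)).zero
  have hsucc (n t : ℕ) : S (P (σ n) (t + 1)) = M.nextState (P (σ n) t) :=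
    Subtype.ext ((hP (σ n)).succ t)
  have key (t : ℕ) (r : ProbabilityMeasure X)
      (hr : Tendsto (fun n => S (P (σ n) t)) atTop (𝓝 r)) :
      ∃ μ, Tendsto (fun n => P (σ n) t) atTop (𝓝 μ) := by
    refine exists_tendsto_of_tendsto_map he hem (hρ t) ?_
    -- The limit has the state law `r`, which lives on `X`.
    have h1 : (ρ t).map (f := Prod.fst) measurable_fst.aemeasurable =
        r.map him.measurable.aemeasurable := by
      refine tendsto_nhds_unique
        (ProbabilityMeasure.tendsto_map_of_tendsto_of_continuous _ _ (hρ t) continuous_fst) ?_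
      refine (ProbabilityMeasure.tendsto_map_of_tendsto_of_continuous _ _ hr
        hi.continuous).congr fun n => Subtype.ext ?_
      simp only [Function.comp, E, S, ProbabilityMeasure.val_eq_to_measure,
        ProbabilityMeasure.toMeasure_map]
      rw [Measure.map_map hi.continuous.measurable M.measurable_state,
        Measure.map_map measurable_fst hem.measurable]
      rfl
    have h2 : (ρ t : Measure Z) (Prod.fst ⁻¹' (range i)ᶜ) = 0 := by
      rw [← Measure.map_apply measurable_fst him.measurableSet_range.compl,
        ← ProbabilityMeasure.toMeasure_map _ measurable_fst.aemeasurable, h1,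
        ProbabilityMeasure.toMeasure_map, him.map_apply]
      simp
    have h3 : (ρ t : Measure Z) (closure (range e))ᶜ = 0 := by
      rw [prob_compl_eq_zero_iff isClosed_closure.measurableSet]
      refine le_antisymm prob_le_one ?_
      refine le_trans ?_ (ProbabilityMeasure.limsup_measure_closed_le_of_tendsto (hρ t)
        isClosed_closure)
      have (n : ℕ) : (E (P (σ n) t) : Measure Z) (closure (range e)) = 1 := by
        refine le_antisymm prob_le_one ?_
        rw [ProbabilityMeasure.toMeasure_map, hem.map_apply,
          preimage_eq_univ_iff.2 subset_closure]
        simp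
      simp only [Function.comp, this, limsup_const, le_refl]
    refine measure_mono_null (fun z hz => ?_) (measure_union_null h2 h3)
    by_contra hcon
    simp only [mem_union, not_or, mem_preimage, mem_compl_iff, not_not] at hcon
    exact hz (husc.mem_range_of_mem_closure hcompact hi hj hcon.2 hcon.1)
  have hconv (t : ℕ) : ∃ μ, Tendsto (fun n => P (σ n) t) atTop (𝓝 μ) := by
    induction t with
    | zero => exact key 0 ⟨ν, inferInstance⟩ (by simp only [hzero]; exact tendsto_const_nhds)
    | succ t ih =>
      obtain ⟨μ, hμ⟩ := ih
      exact key (t + 1) (M.nextState μ) (by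
        simp only [hsucc]; exact M.tendsto_nextState hT hμ)
  choose p hp using hconv
  refine ⟨p, σ, hσ, ⟨fun t => inferInstance, ?_, fun t => ?_⟩, hp⟩
  · have : S (p 0) = ⟨ν, inferInstance⟩ :=
      tendsto_nhds_unique ((hS.tendsto _).comp (hp 0))
        (tendsto_const_nhds.congr fun n => (hzero n).symm)
    exact congrArg Subtype.val this
  · have : S (p (t + 1)) = M.nextState (p t) :=
      tendsto_nhds_unique ((hS.tendsto _).comp (hp (t + 1)))
        ((M.tendsto_nextState hT (hp t)).congr fun n => (hsucc n t).symm)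
    exact congrArg Subtype.val this

end ConstrainedMDP

namespace ConstrainedMDP

/-! ### Value iteration and states with zero cost-to-go -/

section ValueIteration

variable {X A : Type*} [MeasurableSpace X] [MeasurableSpace A] {q : ℕ}

/-- The minimum of a function of the state-action pair over the actions feasible in a state. -/
noncomputable def minOver (M : ConstrainedMDP X A q) (u : M.K → ℝ≥0∞) (x : X) : ℝ≥0∞ :=
  ⨅ a : M.actions x, u ⟨(x, a), a.2⟩

theorem minOver_le (M : ConstrainedMDP X A q) (u : M.K → ℝ≥0∞) (k : M.K) :
    M.minOver u k.1.1 ≤ u k :=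
  iInf_le (fun a : M.actions k.1.1 => u ⟨(k.1.1, a), a.2⟩) ⟨k.1.2, k.2⟩

/-- The minimal expected cost over `n` steps for the running cost `c`. -/
noncomputable def valueIter (M : ConstrainedMDP X A q) (c : M.K → ℝ≥0∞) : ℕ → X → ℝ≥0∞
  | 0 => 0
  | n + 1 => M.minOver fun k => c k + ∫⁻ y, M.valueIter c n y ∂(M.T k)

/-- The expected cost of `n + 1` steps when the first action is prescribed and the other actions are
chosen optimally. -/
noncomputable def stageCost (M : ConstrainedMDP X A q) (c : M.K → ℝ≥0∞) (n : ℕ) (k : M.K) :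
    ℝ≥0∞ :=
  c k + ∫⁻ y, M.valueIter c n y ∂(M.T k)

theorem valueIter_mono (M : ConstrainedMDP X A q) (c : M.K → ℝ≥0∞) (n : ℕ) :
    M.valueIter c n ≤ M.valueIter c (n + 1) := by
  induction n with
  | zero => exact fun x => zero_le
  | succ n ih =>
    intro x
    exact iInf_mono fun a => add_le_add_right (lintegral_mono ih) _

/-- The states from which any finite number of steps can be made at zero cost. -/
def idleStates (M : ConstrainedMDP X A q) (c : M.K → ℝ≥0∞) : Set X :=
  {x | ∀ n, M.valueIter c n x = 0}

/-- The state-action pairs that cost nothing and lead to `idleStates`. -/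
def idlePairs (M : ConstrainedMDP X A q) (c : M.K → ℝ≥0∞) : Set M.K :=
  {k | ∀ n, M.stageCost c n k = 0}

/-- A measure that satisfies the balance equation and has a finite total cost gives a finite
integral to the `n`-step values, since the next state is dominated by the state. -/
theorem lintegral_valueIter_le {M : ConstrainedMDP X A q} {ν : Measure X} {γ : Measure M.K}
    (hγ : M.IsBalanced ν γ) {c : M.K → ℝ≥0∞} (hc : Measurable c)
    (hV : ∀ n, Measurable (M.valueIter c n)) (n : ℕ) :
    ∫⁻ x, M.valueIter c n x ∂(γ.map fun k => k.1.1) ≤ n * ∫⁻ k, c k ∂γ := by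
  induction n with
  | zero => simp [valueIter]
  | succ n ih =>
    calc ∫⁻ x, M.valueIter c (n + 1) x ∂(γ.map fun k => k.1.1)
        = ∫⁻ k, M.valueIter c (n + 1) k.1.1 ∂γ := lintegral_map (hV _) M.measurable_state
      _ ≤ ∫⁻ k, c k + ∫⁻ y, M.valueIter c n y ∂(M.T k) ∂γ :=
          lintegral_mono fun k => M.minOver_le (M.stageCost c n) k
      _ = ∫⁻ k, c k ∂γ + ∫⁻ y, M.valueIter c n y ∂(γ.bind M.T) := by
          rw [lintegral_add_left hc, Measure.lintegral_bind M.T.aemeasurable (hV n).aemeasurable]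
      _ ≤ ∫⁻ k, c k ∂γ + ∫⁻ y, M.valueIter c n y ∂(γ.map fun k => k.1.1) := by
          rw [hγ]
          exact add_le_add_right (lintegral_mono' (Measure.le_add_left le_rfl) le_rfl) _
      _ ≤ ∫⁻ k, c k ∂γ + n * ∫⁻ k, c k ∂γ := add_le_add_right ih _
      _ = (n + 1 : ℕ) * ∫⁻ k, c k ∂γ := by push_cast; ring

end ValueIteration

section Selection

variable {X A : Type*} [TopologicalSpace X] [MeasurableSpace X] [TopologicalSpace A]
  [MeasurableSpace A] {q : ℕ} {M : ConstrainedMDP X A q}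
  (hcompact : ∀ x, IsCompact (M.actions x)) (husc : UpperHemicontinuous M.actions)

include hcompact in
theorem exists_eq_minOver {u : M.K → ℝ≥0∞} (hu : LowerSemicontinuous u) (x : X) :
    ∃ k : M.K, k.1.1 = x ∧ u k = M.minOver u x := by
  have := isCompact_iff_compactSpace.1 (hcompact x)
  have := (M.actions_nonempty x).to_subtype
  have hc : Continuous fun a : M.actions x => (⟨(x, a), a.2⟩ : M.K) := by fun_prop
  obtain ⟨a, -, ha⟩ := ((hu.comp hc).lowerSemicontinuousOn Set.univ).exists_isMinOn
    Set.univ_nonempty isCompact_univ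
  refine ⟨⟨(x, a), a.2⟩, rfl, le_antisymm (le_iInf fun b => ?_) (iInf_le _ a)⟩
  exact ha (Set.mem_univ b)

include hcompact husc in
/-- The easy half of Berge's maximum theorem. -/
theorem lowerSemicontinuous_minOver {u : M.K → ℝ≥0∞} (hu : LowerSemicontinuous u) :
    LowerSemicontinuous (M.minOver u) := by
  rw [lowerSemicontinuous_iff_isClosed_preimage]
  intro c
  have : M.minOver u ⁻¹' Set.Iic c = (fun k : M.K => k.1.1) '' (u ⁻¹' Set.Iic c) := by
    ext x
    constructor
    · intro hx
      obtain ⟨k, hk, hku⟩ := exists_eq_minOver hcompact hu x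
      exact ⟨k, hku.trans_le hx, hk⟩
    · rintro ⟨k, hk, rfl⟩
      exact (M.minOver_le u k).trans hk
  rw [this]
  exact husc.isClosedMap_fst hcompact _ (hu.isClosed_preimage c)

variable [TopologicalSpace.MetrizableSpace X] [TopologicalSpace.MetrizableSpace A] [BorelSpace X]
variable (hT : ∀ f : BoundedContinuousFunction X ℝ, Continuous fun k : M.K => ∫ y, f y ∂(M.T k))
  {c : M.K → ℝ≥0∞} (hc : LowerSemicontinuous c)

include hT hc in
theorem lowerSemicontinuous_stageCost {n : ℕ} (hV : LowerSemicontinuous (M.valueIter c n)) :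
    LowerSemicontinuous (M.stageCost c n) :=
  hc.add (LowerSemicontinuous.lintegral_kernel M.T hT hV)

include hcompact husc hT hc

theorem lowerSemicontinuous_valueIter (n : ℕ) : LowerSemicontinuous (M.valueIter c n) := by
  induction n with
  | zero => exact lowerSemicontinuous_const
  | succ n ih =>
    exact lowerSemicontinuous_minOver hcompact husc (lowerSemicontinuous_stageCost hT hc ih)

theorem measurableSet_idleStates : MeasurableSet (M.idleStates c) := by
  have : M.idleStates c = ⋂ n, M.valueIter c n ⁻¹' {0} := by
    ext; simp [idleStates]
  rw [this]
  exact .iInter fun n => (lowerSemicontinuous_valueIter hcompact husc hT hc n).measurable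
    (measurableSet_singleton 0)

theorem isClosed_idlePairs : IsClosed (M.idlePairs c) := by
  have : M.idlePairs c = ⋂ n, M.stageCost c n ⁻¹' Set.Iic 0 := by
    ext; simp [idlePairs]
  rw [this]
  exact isClosed_iInter fun n => (lowerSemicontinuous_stageCost hT hc
    (lowerSemicontinuous_valueIter hcompact husc hT hc n)).isClosed_preimage 0

/-- An action that keeps all finite-horizon costs at zero exists by compactness: the sets of actions
that are optimal for the horizons `n` decrease to a nonempty set. -/
theorem exists_mem_idlePairs {x : X} (hx : x ∈ M.idleStates c) :
    ∃ k ∈ M.idlePairs c, k.1.1 = x := by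
  have hcomp := isCompact_iff_compactSpace.1 (hcompact x)
  have hcont : Continuous fun a : M.actions x => (⟨(x, a), a.2⟩ : M.K) := by fun_prop
  have hlsc (n : ℕ) := lowerSemicontinuous_stageCost hT hc
    (lowerSemicontinuous_valueIter hcompact husc hT hc n)
  let S : ℕ → Set (M.actions x) := fun n => {a | M.stageCost c n ⟨(x, a), a.2⟩ ≤ 0}
  have hS (n : ℕ) : IsClosed (S n) := ((hlsc n).isClosed_preimage 0).preimage hcont
  obtain ⟨a, ha⟩ := IsCompact.nonempty_iInter_of_sequence_nonempty_isCompact_isClosed S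
    (fun n a ha => le_trans (add_le_add_right (lintegral_mono (M.valueIter_mono c n)) _) ha)
    (fun n => by
      obtain ⟨k, rfl, hk⟩ := exists_eq_minOver hcompact (hlsc n) x
      exact ⟨⟨k.1.2, k.2⟩, (hk.trans (hx (n + 1))).le⟩)
    (hS 0).isCompact hS
  exact ⟨⟨(x, a), a.2⟩, fun n => nonpos_iff_eq_zero.1 (Set.mem_iInter.1 ha n), rfl⟩

theorem T_compl_idleStates {k : M.K} (hk : k ∈ M.idlePairs c) :
    M.T k (M.idleStates c)ᶜ = 0 := by
  rw [← mem_ae_iff]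
  refine ae_all_iff.2 fun n => ?_
  exact (lintegral_eq_zero_iff
    (lowerSemicontinuous_valueIter hcompact husc hT hc n).measurable).1 (add_eq_zero.1 (hk n)).2

/-- A measurable choice of feasible actions that costs nothing on `idleStates` and never leaves
them. -/
theorem exists_idle_selection [SecondCountableTopology X] [SecondCountableTopology A]
    [BorelSpace A] : ∃ f : X → A, Measurable f ∧
    ∀ x, ∃ h : f x ∈ M.actions x, x ∈ M.idleStates c → (⟨(x, f x), h⟩ : M.K) ∈ M.idlePairs c := by
  let G := M.idlePairs c
  let X₀ := M.idleStates c
  have hG : IsClosed G := isClosed_idlePairs hcompact husc hT hc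
  have hX₀ : MeasurableSet X₀ := measurableSet_idleStates hcompact husc hT hc
  let F : X → Set A := fun x => {a | ∃ h : a ∈ M.actions x, x ∈ X₀ → (⟨(x, a), h⟩ : M.K) ∈ G}
  have hFeq (x : X) : F x = Subtype.val ''
      {a : M.actions x | x ∈ X₀ → (⟨(x, a), a.2⟩ : M.K) ∈ G} := by
    ext a; simp [F]
  refine exists_measurable_selection F (fun x => ?_) (fun x => ?_) fun S hS => ?_
  · by_cases hx : x ∈ X₀
    · obtain ⟨k, hk, rfl⟩ := exists_mem_idlePairs hcompact husc hT hc hx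
      exact ⟨k.1.2, k.2, fun _ => hk⟩
    · obtain ⟨a, ha⟩ := M.actions_nonempty x
      exact ⟨a, ha, fun h => absurd h hx⟩
  · have hcomp := isCompact_iff_compactSpace.1 (hcompact x)
    have hcont : Continuous fun a : M.actions x => (⟨(x, a), a.2⟩ : M.K) := by fun_prop
    rw [hFeq]
    refine IsCompact.image (IsClosed.isCompact ?_) continuous_subtype_val
    by_cases hx : x ∈ X₀
    · simp only [hx, true_imp_iff]
      exact hG.preimage hcont
    · simp [hx]
  · have hS' : IsClosed {k : M.K | k.1.2 ∈ S} :=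
      hS.preimage (continuous_snd.comp continuous_subtype_val)
    have : {x | (F x ∩ S).Nonempty} =
        (X₀ ∩ (fun k : M.K => k.1.1) '' (G ∩ {k | k.1.2 ∈ S})) ∪
        (X₀ᶜ ∩ (fun k : M.K => k.1.1) '' {k | k.1.2 ∈ S}) := by
      ext x
      constructor
      · rintro ⟨a, ⟨h, hG⟩, haS⟩
        by_cases hx : x ∈ X₀
        · exact Or.inl ⟨hx, ⟨(x, a), h⟩, ⟨hG hx, haS⟩, rfl⟩
        · exact Or.inr ⟨hx, ⟨(x, a), h⟩, haS, rfl⟩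
      · rintro (⟨hx, k, ⟨hk, hkS⟩, rfl⟩ | ⟨hx, k, hkS, rfl⟩)
        · exact ⟨k.1.2, ⟨k.2, fun _ => hk⟩, hkS⟩
        · exact ⟨k.1.2, ⟨k.2, fun h => absurd h hx⟩, hkS⟩
    rw [this]
    have hcl := husc.isClosedMap_fst hcompact
    exact (hX₀.inter (hcl _ (hG.inter hS')).measurableSet).union
      (hX₀.compl.inter (hcl _ hS').measurableSet)

end Selection
end ConstrainedMDP

/-! ### Disintegration of measures with infinite mass -/

/-- Countably many functions with finite integrals have a common finite integrable weight, positive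
exactly where one of them is positive. -/
theorem exists_weight {X : Type*} [MeasurableSpace X] (μ : Measure X) {V : ℕ → X → ℝ≥0∞}
    (hV : ∀ n, Measurable (V n)) (hint : ∀ n, ∫⁻ x, V n x ∂μ ≠ ∞) :
    ∃ h : X → ℝ≥0∞, Measurable h ∧ (∀ x, h x ≠ ∞) ∧ ∫⁻ x, h x ∂μ ≠ ∞ ∧
      ∀ x, h x = 0 ↔ ∀ n, V n x = 0 := by
  obtain ⟨ε, hε, hsum⟩ := ENNReal.exists_pos_sum_of_countable' one_ne_zero ℕ
  have hI (n : ℕ) : 1 + ∫⁻ x, V n x ∂μ ≠ ∞ := ENNReal.add_ne_top.2 ⟨ENNReal.one_ne_top, hint n⟩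
  let w : ℕ → ℝ≥0∞ := fun n => ε n / (1 + ∫⁻ x, V n x ∂μ)
  have hw (n : ℕ) : w n ≠ 0 := (ENNReal.div_pos (hε n).ne' (hI n)).ne'
  have hwε (n : ℕ) : w n ≤ ε n := ENNReal.div_le_of_le_mul (le_mul_of_one_le_right' le_self_add)
  have hm (n : ℕ) : Measurable fun x => w n * min (V n x) 1 :=
    ((hV n).min measurable_const).const_mul _
  refine ⟨fun x => ∑' n, w n * min (V n x) 1, .tsum hm, fun x => ?_, ?_, fun x => ?_⟩
  · refine ne_top_of_le_ne_top hsum.ne_top (ENNReal.tsum_le_tsum fun n => ?_)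
    exact (mul_le_of_le_one_right' (min_le_right _ _)).trans (hwε n)
  · rw [lintegral_tsum fun n => (hm n).aemeasurable]
    refine ne_top_of_le_ne_top hsum.ne_top (ENNReal.tsum_le_tsum fun n => ?_)
    rw [lintegral_const_mul _ ((hV n).min measurable_const)]
    calc w n * ∫⁻ x, min (V n x) 1 ∂μ ≤ w n * (1 + ∫⁻ x, V n x ∂μ) :=
          mul_le_mul_right ((lintegral_mono fun x => min_le_left _ _).trans le_add_self) _
      _ = ε n := ENNReal.div_mul_cancel (by simp) (hI n)
  · have hmin (a : ℝ≥0∞) : min a 1 = 0 ↔ a = 0 := by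
      rw [← nonpos_iff_eq_zero, min_le_iff]; simp
    simp [ENNReal.tsum_eq_zero, hw, hmin]

/-- A measure on a product with an integrable weight on the first factor can be disintegrated over
the set where the weight is positive, although its marginal may be infinite. -/
theorem exists_kernel_lintegral_eq {X A : Type*} [MeasurableSpace X] [MeasurableSpace A]
    [StandardBorelSpace A] [Nonempty A] (γ : Measure (X × A)) {h : X → ℝ≥0∞} (hm : Measurable h)
    (hfin : ∀ x, h x ≠ ∞) (hint : ∫⁻ x, h x ∂γ.fst ≠ ∞) :
    ∃ κ : Kernel X A, IsMarkovKernel κ ∧ ∀ g : X × A → ℝ≥0∞, Measurable g →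
      ∫⁻ z in {z | h z.1 ≠ 0}, g z ∂γ = ∫⁻ x in {x | h x ≠ 0}, ∫⁻ a, g (x, a) ∂(κ x) ∂γ.fst := by
  have hm1 : Measurable fun z : X × A => h z.1 := hm.comp measurable_fst
  let ρ := γ.withDensity fun z => h z.1
  have hρ : IsFiniteMeasure ρ := by
    refine isFiniteMeasure_withDensity ?_
    rwa [Measure.fst, lintegral_map hm measurable_fst] at hint
  have hfst : ρ.fst = γ.fst.withDensity h := by
    ext s hs
    rw [Measure.fst_apply hs, withDensity_apply _ (measurable_fst hs), withDensity_apply _ hs,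
      Measure.fst, setLIntegral_map hs hm measurable_fst]
  have hS : MeasurableSet {x | h x ≠ 0} := hm (measurableSet_singleton 0).compl
  have hS1 : MeasurableSet {z : X × A | h z.1 ≠ 0} := hm1 (measurableSet_singleton 0).compl
  -- On `{h ≠ 0}` the weight cancels against its inverse.
  have hcancel (x : X) (b : ℝ≥0∞) :
      {x | h x ≠ 0}.indicator (fun _ => b) x = h x * ((h x)⁻¹ * b) := by
    by_cases hx : h x = 0
    · simp [hx]
    · rw [Set.indicator_of_mem (show x ∈ {x | h x ≠ 0} from hx), ← mul_assoc,
        ENNReal.mul_inv_cancel hx (hfin x), one_mul]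
  refine ⟨ρ.condKernel, inferInstance, fun g hg => ?_⟩
  have hg' : Measurable fun z : X × A => (h z.1)⁻¹ * g z := hm1.inv.mul hg
  have hκ : Measurable fun x => ∫⁻ a, g (x, a) ∂(ρ.condKernel x) := hg.lintegral_kernel_prod_right'
  calc ∫⁻ z in {z | h z.1 ≠ 0}, g z ∂γ
      = ∫⁻ z, h z.1 * ((h z.1)⁻¹ * g z) ∂γ := by
        rw [← lintegral_indicator hS1]
        exact lintegral_congr fun z => hcancel z.1 (g z)
    _ = ∫⁻ z, (h z.1)⁻¹ * g z ∂ρ := (lintegral_withDensity_eq_lintegral_mul _ hm1 hg').symm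
    _ = ∫⁻ x, ∫⁻ a, (h x)⁻¹ * g (x, a) ∂(ρ.condKernel x) ∂ρ.fst :=
        (Measure.lintegral_condKernel hg').symm
    _ = ∫⁻ x, (h x)⁻¹ * ∫⁻ a, g (x, a) ∂(ρ.condKernel x) ∂ρ.fst :=
        lintegral_congr fun x => lintegral_const_mul _ (hg.comp measurable_prodMk_left)
    _ = ∫⁻ x, h x * ((h x)⁻¹ * ∫⁻ a, g (x, a) ∂(ρ.condKernel x)) ∂γ.fst := by
        rw [hfst]
        exact lintegral_withDensity_eq_lintegral_mul _ hm (hm.inv.mul hκ)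
    _ = _ := by
        rw [← lintegral_indicator hS]
        exact lintegral_congr fun x => (hcancel x _).symm

namespace ConstrainedMDP

/-! ### Reduction to stationary policies -/

/-- A stationary policy that follows the conditional action law of `γ` where the weight `h` is
positive, up to a null set of states, and a given feasible selector elsewhere. -/
theorem exists_stationaryPolicy {X A : Type*} [MeasurableSpace X] [MeasurableSpace A]
    [StandardBorelSpace A] {q : ℕ} (M : ConstrainedMDP X A q) (γ : Measure M.K) {h : X → ℝ≥0∞}
    (hm : Measurable h) (hfin : ∀ x, h x ≠ ∞) (hint : ∫⁻ x, h x ∂(γ.map fun k => k.1.1) ≠ ∞)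
    {f : X → A} (hf : Measurable f) (hfA : ∀ x, f x ∈ M.actions x) :
    ∃ φ : M.StationaryPolicy, (∀ x, h x = 0 → φ.kernel x = Measure.dirac (f x)) ∧
      ∀ g : M.K → ℝ≥0∞, Measurable g →
        ∫⁻ x in {x | h x ≠ 0}, ∫⁻ k, g k ∂(φ.pairKernel x) ∂(γ.map fun k => k.1.1) =
          ∫⁻ k in {k | h k.1.1 ≠ 0}, g k ∂γ := by
  classical
  rcases isEmpty_or_nonempty X with hX | ⟨⟨x₀⟩⟩
  · have : IsEmpty M.K := ⟨fun k => hX.elim k.1.1⟩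
    refine ⟨⟨0, ⟨fun x => isEmptyElim x⟩, fun x => isEmptyElim x⟩, fun x => isEmptyElim x,
      fun g hg => ?_⟩
    simp [Measure.eq_zero_of_isEmpty]
  have : Nonempty A := ⟨f x₀⟩
  have he := MeasurableEmbedding.subtype_coe M.measurableSet_feasiblePairs
  have hfst : (γ.map Subtype.val).fst = γ.map fun k => k.1.1 :=
    Measure.map_map measurable_fst measurable_subtype_coe
  obtain ⟨κ, hκ, hdis⟩ := exists_kernel_lintegral_eq (γ.map Subtype.val) hm hfin (hfst ▸ hint)
  have hS : MeasurableSet {x | h x ≠ 0} := hm (measurableSet_singleton 0).compl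
  have hS1 : MeasurableSet {z : X × A | h z.1 ≠ 0} :=
    (hm.comp measurable_fst) (measurableSet_singleton 0).compl
  rw [hfst] at hdis
  have hmap (g : X × A → ℝ≥0∞) (hg : Measurable g) :
      ∫⁻ z in {z | h z.1 ≠ 0}, g z ∂(γ.map Subtype.val) = ∫⁻ k in {k | h k.1.1 ≠ 0}, g k.1 ∂γ :=
    setLIntegral_map hS1 hg measurable_subtype_coe
  let s : Set X := {x | h x ≠ 0} ∩ {x | κ x (M.actions x) = 1}
  have hs : MeasurableSet s := hS.inter
    (Kernel.measurable_kernel_prodMk_left M.measurableSet_feasiblePairs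
      (measurableSet_singleton 1))
  -- The conditional laws are carried by the feasible actions almost surely.
  have hae : ∀ᵐ x ∂((γ.map fun k => k.1.1).restrict {x | h x ≠ 0}), κ x (M.actions x) = 1 := by
    have hK := M.measurableSet_feasiblePairs.compl
    have h0 := hdis ((feasiblePairs M.actions)ᶜ.indicator 1) (measurable_one.indicator hK)
    rw [hmap _ (measurable_one.indicator hK)] at h0
    have hz : ∀ k : M.K, (feasiblePairs M.actions)ᶜ.indicator (1 : X × A → ℝ≥0∞) k.1 = 0 :=
      fun k => Set.indicator_of_notMem (Set.notMem_compl_iff.2 k.2) _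
    simp only [hz, lintegral_zero] at h0
    have hmeas : Measurable fun x =>
        ∫⁻ a, (feasiblePairs M.actions)ᶜ.indicator (1 : X × A → ℝ≥0∞) (x, a) ∂(κ x) :=
      (measurable_one.indicator hK).lintegral_kernel_prod_right'
    filter_upwards [(lintegral_eq_zero_iff hmeas).1 h0.symm] with x hx
    rw [← prob_compl_eq_zero_iff (M.measurableSet_actions x)]
    have : ∫⁻ a, (M.actions x)ᶜ.indicator (1 : A → ℝ≥0∞) a ∂(κ x) = 0 := hx
    rwa [lintegral_indicator_one (M.measurableSet_actions x).compl] at this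
  let φ : M.StationaryPolicy :=
    { kernel := Kernel.piecewise hs κ (Kernel.deterministic f hf)
      isMarkovKernel := inferInstance
      feasible := fun x => by
        rw [Kernel.piecewise_apply]
        split_ifs with hx
        · exact hx.2
        · rw [Kernel.deterministic_apply, Measure.dirac_apply_of_mem (hfA x)] }
  refine ⟨φ, fun x hx => ?_, fun g hg => ?_⟩
  · have : x ∉ s := fun h => h.1 hx
    change Kernel.piecewise hs κ (Kernel.deterministic f hf) x = _
    rw [Kernel.piecewise_apply, if_neg this, Kernel.deterministic_apply]
  · let g' : X × A → ℝ≥0∞ := Function.extend Subtype.val g 0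
    have hg' : Measurable g' := he.measurable_extend hg measurable_zero
    have hgg' (k : M.K) : g k = g' k.1 := (Subtype.val_injective.extend_apply g 0 k).symm
    simp only [hgg']
    rw [← hmap g' hg', hdis g' hg']
    refine lintegral_congr_ae ?_
    filter_upwards [hae, ae_restrict_mem hS] with x hx hxS
    rw [φ.lintegral_pairKernel x hg']
    have : x ∈ s := ⟨hxS, hx⟩
    change ∫⁻ a, g' (x, a) ∂(Kernel.piecewise hs κ (Kernel.deterministic f hf) x) = _
    rw [Kernel.piecewise_apply, if_pos this]

variable {X A : Type*} [MeasurableSpace X] [MeasurableSpace A] {q : ℕ}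

/-- If a stationary policy follows the conditional action law of a balanced measure `γ` on `S` and
never leads back to `S` from outside, then the expected number of visits to `S` is dominated by the
state marginal of `γ`. -/
theorem sum_setLIntegral_marginal_le {M : ConstrainedMDP X A q} {ν : Measure X}
    [IsProbabilityMeasure ν] {γ : Measure M.K} (hγ : M.IsBalanced ν γ) {S : Set X}
    (hS : MeasurableSet S) {φ : M.StationaryPolicy}
    (hout : ∀ x ∉ S, ∀ᵐ k ∂(φ.pairKernel x), M.T k S = 0)
    (hφ : ∀ g : M.K → ℝ≥0∞, Measurable g →
      ∫⁻ x in S, ∫⁻ k, g k ∂(φ.pairKernel x) ∂(γ.map fun k => k.1.1) =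
        ∫⁻ k in {k | k.1.1 ∈ S}, g k ∂γ)
    {g : X → ℝ≥0∞} (hg : Measurable g) (N : ℕ) :
    ∑ t ∈ Finset.range N, ∫⁻ x in S, g x ∂((φ.toPolicy.marginal ν t).map fun k => k.1.1) ≤
      ∫⁻ x in S, g x ∂(γ.map fun k => k.1.1) := by
  have hflow := φ.toPolicy.isMarginalFlow_marginal ν
  induction N generalizing g with
  | zero => simp
  | succ N ih =>
    let gS : X → ℝ≥0∞ := S.indicator g
    have hgS : Measurable gS := hg.indicator hS
    let u : M.K → ℝ≥0∞ := fun k => ∫⁻ y, gS y ∂(M.T k)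
    have hu : Measurable u := hgS.lintegral_kernel
    let G : X → ℝ≥0∞ := fun x => ∫⁻ k, u k ∂(φ.pairKernel x)
    have hG : Measurable G := hu.lintegral_kernel
    have hG0 (x : X) (hx : x ∉ S) : G x = 0 := by
      refine (lintegral_eq_zero_iff hu).2 ?_
      filter_upwards [hout x hx] with k hk
      change ∫⁻ y, S.indicator g y ∂(M.T k) = 0
      rw [lintegral_indicator hS, Measure.restrict_eq_zero.2 hk, lintegral_zero_measure]
    have hnext (t : ℕ) :
        ∫⁻ x in S, g x ∂((φ.toPolicy.marginal ν (t + 1)).map fun k => k.1.1) =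
          ∫⁻ x in S, G x ∂((φ.toPolicy.marginal ν t).map fun k => k.1.1) := by
      rw [← lintegral_indicator hS, hflow.succ,
        Measure.lintegral_bind M.T.aemeasurable hgS.aemeasurable, φ.marginal_eq_bind ν t,
        Measure.lintegral_bind (Kernel.aemeasurable _) hu.aemeasurable,
        ← φ.marginal_eq_bind ν t, ← lintegral_indicator hS]
      refine lintegral_congr fun x => ?_
      by_cases hx : x ∈ S
      · rw [Set.indicator_of_mem hx]
      · rw [Set.indicator_of_notMem hx]; exact hG0 x hx
    rw [Finset.sum_range_succ', hflow.zero]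
    simp only [hnext]
    calc _ ≤ ∫⁻ x in S, G x ∂(γ.map fun k => k.1.1) + ∫⁻ x in S, g x ∂ν := by
          gcongr; exact ih hG
      _ = ∫⁻ k in {k | k.1.1 ∈ S}, u k ∂γ + ∫⁻ x, gS x ∂ν := by
          rw [hφ u hu, lintegral_indicator hS]
      _ ≤ ∫⁻ k, u k ∂γ + ∫⁻ x, gS x ∂ν := by
          gcongr; exact Measure.restrict_le_self
      _ = ∫⁻ x in S, g x ∂(γ.map fun k => k.1.1) := by
          rw [← lintegral_indicator hS, hγ, lintegral_add_measure,
            Measure.lintegral_bind M.T.aemeasurable hgS.aemeasurable, add_comm]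

open Set in
/-- Every balanced measure with finite costs is dominated, in all costs at once, by a stationary
policy. Where the cost-to-go can be kept at zero, the policy does so; elsewhere the marginal of the
measure is σ-finite, and the policy follows the conditional law of the action. -/
theorem exists_stationaryPolicy_value_le {X A : Type*} [TopologicalSpace X]
    [TopologicalSpace.MetrizableSpace X] [SecondCountableTopology X] [MeasurableSpace X]
    [BorelSpace X] [TopologicalSpace A] [TopologicalSpace.MetrizableSpace A]
    [SecondCountableTopology A] [MeasurableSpace A] [BorelSpace A] [StandardBorelSpace A]
    {q : ℕ} {M : ConstrainedMDP X A q} {ν : Measure X} [IsProbabilityMeasure ν]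
    (hcompact : ∀ x, IsCompact (M.actions x)) (husc : UpperHemicontinuous M.actions)
    (hlsc : ∀ i, LowerSemicontinuous (M.cost i))
    (hT : ∀ f : BoundedContinuousFunction X ℝ, Continuous fun k : M.K => ∫ y, f y ∂(M.T k))
    {γ : Measure M.K} (hγ : M.IsBalanced ν γ) (hfin : ∀ i, M.costIntegral γ i ≠ ∞) :
    ∃ φ : M.StationaryPolicy, ∀ i, φ.toPolicy.value ν i ≤ M.costIntegral γ i := by
  have hlsc' (i : Fin (q + 1)) : LowerSemicontinuous fun k => ENNReal.ofReal (M.cost i k) :=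
    ENNReal.continuous_ofReal.comp_lowerSemicontinuous (hlsc i) fun a b h =>
      ENNReal.ofReal_le_ofReal h
  have hcm (i : Fin (q + 1)) : Measurable fun k => ENNReal.ofReal (M.cost i k) :=
    (M.measurable_cost i).ennreal_ofReal
  -- The sum of all costs vanishes only where each cost does.
  let c : M.K → ℝ≥0∞ := fun k => ∑ i, ENNReal.ofReal (M.cost i k)
  have hc : LowerSemicontinuous c := lowerSemicontinuous_sum fun i _ => hlsc' i
  have hcfin : ∫⁻ k, c k ∂γ ≠ ∞ := by
    rw [lintegral_finsetSum _ fun i _ => hcm i]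
    exact ENNReal.sum_ne_top.2 fun i _ => hfin i
  have hVm (n : ℕ) : Measurable (M.valueIter c n) :=
    (lowerSemicontinuous_valueIter hcompact husc hT hc n).measurable
  obtain ⟨h, hm, hhfin, hint, h0⟩ := exists_weight (γ.map fun k => k.1.1) hVm fun n =>
    ne_top_of_le_ne_top (ENNReal.mul_ne_top (ENNReal.natCast_ne_top n) hcfin)
      (lintegral_valueIter_le hγ hc.measurable hVm n)
  obtain ⟨f, hf, hfG⟩ := exists_idle_selection hcompact husc hT hc
  choose hfA hfG using hfG
  obtain ⟨φ, hφ0, hφ⟩ := M.exists_stationaryPolicy γ hm hhfin hint hf hfA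
  have hS : MeasurableSet {x | h x ≠ 0} := hm (measurableSet_singleton 0).compl
  have hScompl : (M.idleStates c)ᶜ = {x | h x ≠ 0} := by
    ext x
    rw [mem_compl_iff, mem_ofPred, Ne, h0]
    rfl
  -- From the idle states the policy uses idle pairs only.
  have hidle (x : X) (hx : x ∉ {x | h x ≠ 0}) :
      ∀ᵐ k ∂(φ.pairKernel x), k ∈ M.idlePairs c := by
    have hx0 : h x = 0 := not_not.1 hx
    have hGm : MeasurableSet (Subtype.val '' (M.idlePairs c)ᶜ : Set (X × A)) :=
      (MeasurableEmbedding.subtype_coe M.measurableSet_feasiblePairs).measurableSet_image.2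
        (isClosed_idlePairs hcompact husc hT hc).measurableSet.compl
    have hval := φ.pairKernel_map_val x
    rw [hφ0 x hx0, Measure.dirac_prod_dirac] at hval
    have := congrArg (fun μ => μ (Subtype.val '' (M.idlePairs c)ᶜ : Set (X × A))) hval
    simp only [Measure.map_apply measurable_subtype_coe hGm, Measure.dirac_apply' _ hGm,
      preimage_image_eq _ Subtype.val_injective] at this
    refine mem_ae_iff.2 (this.trans (indicator_of_notMem ?_ _))
    rintro ⟨k, hk, hkx⟩
    obtain rfl : k = ⟨(x, f x), hfA x⟩ := Subtype.ext hkx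
    exact hk (hfG x ((h0 x).1 hx0))
  have hout (x : X) (hx : x ∉ {x | h x ≠ 0}) :
      ∀ᵐ k ∂(φ.pairKernel x), M.T k {x | h x ≠ 0} = 0 := by
    filter_upwards [hidle x hx] with k hk
    rw [← hScompl]
    exact T_compl_idleStates hcompact husc hT hc hk
  refine ⟨φ, fun i => ?_⟩
  let G : X → ℝ≥0∞ := fun x => ∫⁻ k, ENNReal.ofReal (M.cost i k) ∂(φ.pairKernel x)
  have hG : Measurable G := (hcm i).lintegral_kernel
  have hG0 (x : X) (hx : x ∉ {x | h x ≠ 0}) : G x = 0 := by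
    refine (lintegral_eq_zero_iff (hcm i)).2 ?_
    filter_upwards [hidle x hx] with k hk
    exact Finset.sum_eq_zero_iff.1 (add_eq_zero.1 (hk 0)).1 i (Finset.mem_univ i)
  have hstep (t : ℕ) : ∫⁻ k, ENNReal.ofReal (M.cost i k) ∂(φ.toPolicy.marginal ν t) =
      ∫⁻ x in {x | h x ≠ 0}, G x ∂((φ.toPolicy.marginal ν t).map fun k => k.1.1) := by
    rw [φ.marginal_eq_bind ν t, Measure.lintegral_bind (Kernel.aemeasurable _)
      (hcm i).aemeasurable, ← φ.marginal_eq_bind ν t, ← lintegral_indicator hS]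
    refine lintegral_congr fun x => ?_
    by_cases hx : x ∈ {x | h x ≠ 0}
    · rw [indicator_of_mem hx]
    · rw [indicator_of_notMem hx]; exact hG0 x hx
  rw [← Policy.costIntegral_occupationMeasure, costIntegral]
  change ∫⁻ k, _ ∂(Measure.sum (φ.toPolicy.marginal ν)) ≤ _
  rw [lintegral_sum_measure, ENNReal.tsum_eq_iSup_nat]
  refine iSup_le fun N => ?_
  simp only [hstep]
  refine (sum_setLIntegral_marginal_le hγ hS hout hφ hG N).trans ?_
  rw [hφ _ (hcm i)]
  exact lintegral_mono' Measure.restrict_le_self le_rfl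

end ConstrainedMDP

namespace ConstrainedMDP

/-! ### Existence of an optimal stationary policy -/

open Filter Topology in
theorem costIntegral_sum_le_liminf {X A : Type*} [TopologicalSpace X]
    [TopologicalSpace.MetrizableSpace X] [SecondCountableTopology X] [MeasurableSpace X]
    [BorelSpace X] [TopologicalSpace A] [TopologicalSpace.MetrizableSpace A]
    [SecondCountableTopology A] [MeasurableSpace A] [BorelSpace A] {q : ℕ}
    {M : ConstrainedMDP X A q} (hlsc : ∀ i, LowerSemicontinuous (M.cost i))
    {P : ℕ → ℕ → ProbabilityMeasure M.K} {p : ℕ → ProbabilityMeasure M.K}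
    (hP : ∀ t, Tendsto (fun n => P n t) atTop (𝓝 (p t))) (i : Fin (q + 1)) :
    M.costIntegral (Measure.sum fun t => (p t : Measure M.K)) i ≤
      liminf (fun n => M.costIntegral (Measure.sum fun t => (P n t : Measure M.K)) i) atTop := by
  have hc : LowerSemicontinuous fun k => ENNReal.ofReal (M.cost i k) :=
    ENNReal.continuous_ofReal.comp_lowerSemicontinuous (hlsc i) fun a b h =>
      ENNReal.ofReal_le_ofReal h
  simp only [costIntegral, lintegral_sum_measure]
  simp only [← lintegral_count]
  refine le_trans (lintegral_mono fun t => ?_)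
    (lintegral_liminf_le fun n => measurable_from_top)
  exact hc.lintegral_le_liminf fun G hG =>
    ProbabilityMeasure.le_liminf_measure_open_of_tendsto (hP t) hG

open Filter in
/-- The linear program attains its infimum. A minimizing sequence may be taken to consist of
occupation measures of stationary policies; the time marginals of these converge along a
subsequence, and the sum of the limits is optimal since the costs are lower semicontinuous. -/
theorem exists_lpFeasible_costIntegral_le {X A : Type*} [TopologicalSpace X]
    [TopologicalSpace.MetrizableSpace X] [SecondCountableTopology X] [MeasurableSpace X]
    [BorelSpace X] [StandardBorelSpace X] [TopologicalSpace A]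
    [TopologicalSpace.MetrizableSpace A] [SecondCountableTopology A] [MeasurableSpace A]
    [BorelSpace A] [StandardBorelSpace A] {q : ℕ} (M : ConstrainedMDP X A q) (ν : Measure X)
    [IsProbabilityMeasure ν] (hcompact : ∀ x, IsCompact (M.actions x))
    (husc : UpperHemicontinuous M.actions) (hlsc : ∀ i, LowerSemicontinuous (M.cost i))
    (hT : ∀ f : BoundedContinuousFunction X ℝ, Continuous fun k : M.K => ∫ y, f y ∂(M.T k))
    (hdom : ∀ γ ∈ M.lpFeasible ν, M.costIntegral γ 0 ≠ ∞ →
      ∃ φ : M.StationaryPolicy, ∀ i, φ.toPolicy.value ν i ≤ M.costIntegral γ i)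
    (hfin : (⨅ γ ∈ M.lpFeasible ν, M.costIntegral γ 0) ≠ ∞) :
    ∃ γ ∈ M.lpFeasible ν, M.costIntegral γ 0 ≤ ⨅ γ ∈ M.lpFeasible ν, M.costIntegral γ 0 := by
  set J := ⨅ γ ∈ M.lpFeasible ν, M.costIntegral γ 0
  obtain ⟨ε, -, hεpos, hε⟩ := exists_seq_strictAnti_tendsto' (zero_lt_one (α := ℝ≥0∞))
  have hseq (n : ℕ) : ∃ φ : M.StationaryPolicy, φ.toPolicy.value ν 0 ≤ J + ε n ∧
      φ.toPolicy ∈ M.feasiblePolicies ν := by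
    obtain ⟨γ, hγ⟩ := iInf_lt_iff.1 (ENNReal.lt_add_right hfin (hεpos n).1.ne')
    obtain ⟨hγL, hγJ⟩ := iInf_lt_iff.1 hγ
    obtain ⟨φ, hφ⟩ := hdom γ hγL hγJ.ne_top
    exact ⟨φ, (hφ 0).trans hγJ.le, fun j =>
      (EReal.coe_ennreal_le_coe_ennreal_iff.2 (hφ j.succ)).trans (hγL.2 j)⟩
  choose φ hφJ hφc using hseq
  obtain ⟨p, σ, hσ, hp, hlim⟩ := M.exists_subseq_tendsto_flow ν hcompact husc hT
    (fun n t => ⟨(φ n).toPolicy.marginal ν t, inferInstance⟩)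
    fun n => (φ n).toPolicy.isMarginalFlow_marginal ν
  have hle (i : Fin (q + 1)) : M.costIntegral (Measure.sum fun t => (p t : Measure M.K)) i ≤
      liminf (fun n => (φ (σ n)).toPolicy.value ν i) atTop := by
    refine (costIntegral_sum_le_liminf hlsc hlim i).trans_eq ?_
    congr 1 with n
    exact (φ (σ n)).toPolicy.costIntegral_occupationMeasure ν i
  refine ⟨Measure.sum fun t => (p t : Measure M.K), ⟨isBalanced_iff.1 hp.isBalanced_sum,
    fun j => ?_⟩, ?_⟩
  · have hR (n : ℕ) := hφc (σ n) j
    have h0 : (0 : EReal) ≤ M.limit j := (EReal.coe_ennreal_nonneg _).trans (hR 0)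
    rw [← EReal.coe_toENNReal h0] at hR ⊢
    simp only [EReal.coe_ennreal_le_coe_ennreal_iff] at hR ⊢
    refine (hle j.succ).trans ((liminf_le_liminf (Eventually.of_forall hR)).trans_eq ?_)
    exact liminf_const _
  · refine (hle 0).trans ((liminf_le_liminf (Eventually.of_forall fun n => hφJ (σ n))).trans_eq ?_)
    have := (hε.comp hσ.tendsto_atTop).const_add J
    rw [add_zero] at this
    exact this.liminf_eq

end ConstrainedMDP

/-- `X` and `A` are Borel spaces (Borel subsets of Polish spaces): separable metrizable spaces whose
Borel σ-algebra is standard. -/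
theorem theorem7p2
    {X A : Type*}
    [TopologicalSpace X] [TopologicalSpace.MetrizableSpace X] [SecondCountableTopology X]
    [MeasurableSpace X] [BorelSpace X] [StandardBorelSpace X]
    [TopologicalSpace A] [TopologicalSpace.MetrizableSpace A] [SecondCountableTopology A]
    [MeasurableSpace A] [BorelSpace A] [StandardBorelSpace A]
    {q : ℕ} (M : ConstrainedMDP X A q)
    (ν : Measure X) [IsProbabilityMeasure ν]
    (hcompact : ∀ x, IsCompact (M.actions x))
    (husc : UpperHemicontinuous M.actions)
    (hnonneg : ∀ i k, 0 ≤ M.cost i k)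
    (hlsc : ∀ i, LowerSemicontinuous (M.cost i))
    (hT : ∀ f : BoundedContinuousFunction X ℝ, Continuous fun k : M.K => ∫ y, f y ∂(M.T k))
    (hβ : ∃ β ∈ M.lpFeasible ν, M.costIntegral β 0 < ∞) :
    ∃ φ : M.StationaryPolicy,
      φ.toPolicy ∈ M.feasiblePolicies ν ∧
      φ.toPolicy.occupationMeasure ν ∈ M.lpFeasible ν ∧
      (⨅ γ ∈ M.lpFeasible ν, M.costIntegral γ 0)
        = M.costIntegral (φ.toPolicy.occupationMeasure ν) 0 ∧
      M.costIntegral (φ.toPolicy.occupationMeasure ν) 0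
        = (⨅ π ∈ M.feasiblePolicies ν, π.value ν 0) ∧
      (⨅ π ∈ M.feasiblePolicies ν, π.value ν 0) = φ.toPolicy.value ν 0 := by

  obtain ⟨β, hβL, hβ0⟩ := hβ
  have hdom (γ : Measure M.K) (hγ : γ ∈ M.lpFeasible ν) (h0 : M.costIntegral γ 0 ≠ ∞) :
      ∃ φ : M.StationaryPolicy, ∀ i, φ.toPolicy.value ν i ≤ M.costIntegral γ i := by
    refine ConstrainedMDP.exists_stationaryPolicy_value_le hcompact husc hlsc hT
      (ConstrainedMDP.isBalanced_iff.2 hγ.1) fun i => ?_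
    induction i using Fin.cases with
    | zero => exact h0
    | succ j =>
      intro htop
      have := hγ.2 j
      rw [htop, EReal.coe_ennreal_top] at this
      exact (EReal.coe_lt_top _).not_ge this
  obtain ⟨γ, hγL, hγ⟩ := M.exists_lpFeasible_costIntegral_le ν hcompact husc hlsc hT hdom
    ((iInf₂_le β hβL).trans_lt hβ0).ne
  have hγ0 : M.costIntegral γ 0 ≠ ∞ := (hγ.trans_lt ((iInf₂_le β hβL).trans_lt hβ0)).ne
  obtain ⟨φ, hφ⟩ := hdom γ hγL hγ0
  have hφc : φ.toPolicy ∈ M.feasiblePolicies ν := fun j =>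
    (EReal.coe_ennreal_le_coe_ennreal_iff.2 (hφ j.succ)).trans (hγL.2 j)
  have hφL := φ.toPolicy.occupationMeasure_mem_lpFeasible ν hφc
  have hLφ : (⨅ γ ∈ M.lpFeasible ν, M.costIntegral γ 0) = φ.toPolicy.value ν 0 :=
    le_antisymm ((iInf₂_le _ hφL).trans_eq (φ.toPolicy.costIntegral_occupationMeasure ν 0))
      ((hφ 0).trans hγ)
  have hpol : (⨅ π ∈ M.feasiblePolicies ν, π.value ν 0) = φ.toPolicy.value ν 0 := by
    refine le_antisymm (iInf₂_le _ hφc) (le_iInf₂ fun π hπ => ?_)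
    rw [← hLφ, ← π.costIntegral_occupationMeasure ν 0]
    exact iInf₂_le _ (π.occupationMeasure_mem_lpFeasible ν hπ)
  have hocc := φ.toPolicy.costIntegral_occupationMeasure ν 0
  exact ⟨φ, hφc, hφL, hLφ.trans hocc.symm, hocc.trans hpol.symm, hpol⟩
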